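/- An \emph{oposet} $(I,\leq,\perp)$ is a poset $(I,\leq)$ with a symmetric irreflexive relation $\perp$ such that $x\perp y$ implies that $x,y$ are not $\leq$-comparable, and such that $x\leq y$ and $y\perp z$ imply $x\perp z$. A \emph{quandle system} consists of an oposet $(I,\leq,\perp)$, a collection of groups $(G_i)_{i\in I}$, and, for every $i\in I$, an action $(b,a)\mapsto b\ast a$ of $G_i$ by automorphisms on the groupoid $\bigsqcup_{j<i}G_j$, where an action is written on the left but composes in the order of the product, i.e. $1\ast a=a$ and $(bc)\ast a=c\ast(b\ast a)$; write $b\ast j$ for the index with $b\ast G_j=G_{b\ast j}$. One requires that each $b\in G_i$ preserves $\leq$ and $\perp$ on the set of objects $\{j\in I\mid j<i\}$, and that the quandle relation $c\ast(b\ast a)=(c\ast b)\ast(c\ast a)$ holds for all $i<j<k$, $a\in G_i$, $b\in G_j$, $c\in G_k$. The \emph{quandle product} $\mathfrak{Q}$ is the quotient of the free product $\ast_{i\in I}G_i$ by the normal closure of the relations $ab=ba$ for $a\in G_i$, $b\in G_j$, $i\perp j$, and $ab=b(b\ast a)$ for $a\in G_i$, $b\in G_j$, $i<j$. A \emph{word}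 is a finite sequence of letters from $\bigsqcup_{i\in I}G_i\setminus\{1\}$; it represents the product of its letters in $\mathfrak{Q}$. Consider the following moves on two consecutive letters of a word: \begin{itemize} \item a \emph{$\perp$-commutation} replaces $ab$ by $ba$, where $a\in G_i$, $b\in G_j$, $i\perp j$; \item a \emph{fusion} replaces $ab$, where $a,b\in G_i$, by the single letter of $G_i$ that is the product of $a$ and $b$ if this product is non-trivial, and deletes $ab$ otherwise; \item a \emph{twisted commutation} replaces $ab$ by $b\,(b\ast a)$, or $ba$ by $(b^{-1}\ast a)\,b$, where $a\in G_i$, $b\in G_j$, $i<j$. \end{itemize} A word is \emph{$\mathfrak{Q}$-reduced} if no finite sequence of $\perp$-commutations, fusions and twisted commutations turns it into a shorter word. \textbf{Theorem.} Let $\mathfrak{Q}$ be a quandle product and $g\in\mathfrak{Q}$. A word representing $g$ has minimal length among all words representing $g$ if and only if it is $\mathfrak{Q}$-reduced. Moreover, any two words of minimal length representing $g$ can be obtained from one another by a finite sequence of $\perp$-commutations and twisted commutations. -/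

import Mathlib

/-- An oposet: a poset with a symmetric irreflexive orthogonality relation such that orthogonal
elements are not comparable and orthogonality is inherited by smaller elements. -/
class Oposet (I : Type*) extends PartialOrder I where
  Perp : I → I → Prop
  perp_symm : ∀ x y : I, Perp x y → Perp y x
  perp_irrefl : ∀ x : I, ¬ Perp x x
  not_comparable_of_perp : ∀ x y : I, Perp x y → ¬ x ≤ y ∧ ¬ y ≤ x
  perp_of_le_of_perp : ∀ x y z : I, x ≤ y → Perp y z → Perp x z

/-- An automorphism of the groupoid `⨆ j, G j` (the disjoint union of the groups `G j`): a
permutation of the objects together with an isomorphism from each vertex group `G j` onto the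
vertex group at the image of `j`. -/
structure DisjUnionAut {J : Type*} (G : J → Type*) [∀ j, Group (G j)] where
  obj : Equiv.Perm J
  iso : ∀ j : J, G j ≃* G (obj j)

/-- The image of an element `x = ⟨j, a⟩` of the disjoint union of the groups `G j`. -/
def DisjUnionAut.app {J : Type*} {G : J → Type*} [∀ j, Group (G j)] (φ : DisjUnionAut G)
    (x : Σ j, G j) : Σ j, G j :=
  ⟨φ.obj x.1, φ.iso x.1 x.2⟩

/-- The data of a quandle system over an oposet `I` and a collection of groups `G i`, without the
quandle relation: for each `i`, an action of `G i` on the groupoid `⨆ j < i, G j`, which preserves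
`≤` and orthogonality on objects. The element `b ∗ a` is `(act b).app a`.

The actions are written on the left but compose in the order of the product of the group:
`(b * c) ∗ a = c ∗ (b ∗ a)`. This is what the defining relations `a b = b (b ∗ a)`, that is
`b ∗ a = b⁻¹ a b`, require. -/
structure GroupoidActions (I : Type*) [Oposet I] (G : I → Type*) [∀ i, Group (G i)] where
  act : ∀ {i : I}, G i → DisjUnionAut (fun j : Set.Iio i => G j)
  act_one : ∀ (i : I) (x : Σ j : Set.Iio i, G j), (act (1 : G i)).app x = x
  act_mul : ∀ (i : I) (b c : G i) (x : Σ j : Set.Iio i, G j),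
    (act (b * c)).app x = (act c).app ((act b).app x)
  act_le : ∀ (i : I) (b : G i) (j k : Set.Iio i),
    j.1 ≤ k.1 → ((act b).obj j).1 ≤ ((act b).obj k).1
  act_perp : ∀ (i : I) (b : G i) (j k : Set.Iio i),
    Oposet.Perp j.1 k.1 → Oposet.Perp ((act b).obj j).1 ((act b).obj k).1

namespace GroupoidActions

variable {I : Type*} [Oposet I] {G : I → Type*} [∀ i, Group (G i)] (A : GroupoidActions I G)

/-- The index `b ∗ i` for `b ∈ G j` and `i < j`. -/
def starIdx {i j : I} (h : i < j) (b : G j) : I := ((A.act b).obj ⟨i, h⟩).1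

/-- The element `b ∗ a ∈ G (b ∗ i)` for `a ∈ G i`, `b ∈ G j` and `i < j`. -/
def star {i j : I} (h : i < j) (b : G j) (a : G i) : G (A.starIdx h b) :=
  (A.act b).iso ⟨i, h⟩ a

theorem starIdx_lt {i j : I} (h : i < j) (b : G j) : A.starIdx h b < j :=
  ((A.act b).obj ⟨i, h⟩).2

theorem starIdx_lt_starIdx {i j k : I} (hij : i < j) (hjk : j < k) (c : G k) :
    A.starIdx (hij.trans hjk) c < A.starIdx hjk c := by
  refine lt_of_le_of_ne (A.act_le k c ⟨i, hij.trans hjk⟩ ⟨j, hjk⟩ hij.le) fun h => hij.ne ?_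
  exact congrArg Subtype.val ((A.act c).obj.injective (Subtype.ext h))

theorem star_ne_one {i j : I} (h : i < j) (b : G j) {a : G i} (ha : a ≠ 1) :
    A.star h b a ≠ 1 := fun hs =>
  ha (((A.act b).iso ⟨i, h⟩).injective (hs.trans (map_one _).symm))

end GroupoidActions

/-- A quandle system over the oposet `I` and the collection of groups `G i`: actions as above that
satisfy the quandle relation `c ∗ (b ∗ a) = (c ∗ b) ∗ (c ∗ a)` for all `a ∈ G i`, `b ∈ G j`,
`c ∈ G k` with `i < j < k`. -/
structure QuandleSystem (I : Type*) [Oposet I] (G : I → Type*) [∀ i, Group (G i)] extends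
    GroupoidActions I G where
  quandle : ∀ (i j k : I) (hij : i < j) (hjk : j < k) (a : G i) (b : G j) (c : G k),
    (⟨_, toGroupoidActions.star ((toGroupoidActions.starIdx_lt hij b).trans hjk) c
        (toGroupoidActions.star hij b a)⟩ : Σ l, G l) =
      ⟨_, toGroupoidActions.star (toGroupoidActions.starIdx_lt_starIdx hij hjk c)
        (toGroupoidActions.star hjk c b) (toGroupoidActions.star (hij.trans hjk) c a)⟩

/-- A letter: an element of the alphabet `⨆ i, G i \ {1}`, that is, a nontrivial element `val` of a
factor `G idx`. -/
structure Letter {I : Type*} (G : I → Type*) [∀ i, Group (G i)] where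
  {idx : I}
  val : G idx
  ne_one : val ≠ 1

namespace QuandleSystem

open Monoid (CoprodI)

variable {I : Type*} [Oposet I] {G : I → Type*} [∀ i, Group (G i)] (S : QuandleSystem I G)

/-- The relators of the quandle product: `ab = ba` for `a ∈ G i`, `b ∈ G j` with `i`, `j`
orthogonal, and `ab = b (b ∗ a)` for `a ∈ G i`, `b ∈ G j` with `i < j`. -/
def relators : Set (CoprodI G) :=
  {x | ∃ (i j : I) (a : G i) (b : G j), Oposet.Perp i j ∧
      x = (CoprodI.of a * CoprodI.of b) * (CoprodI.of b * CoprodI.of a)⁻¹} ∪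
  {x | ∃ (i j : I) (h : i < j) (a : G i) (b : G j),
      x = (CoprodI.of a * CoprodI.of b) * (CoprodI.of b * CoprodI.of (S.star h b a))⁻¹}

/-- The quandle product: the free product of the factors modulo the relators. -/
abbrev Product : Type _ := CoprodI G ⧸ Subgroup.normalClosure S.relators

/-- The element of the quandle product represented by a word. -/
def eval (w : List (Letter G)) : S.Product :=
  (w.map fun s => (QuotientGroup.mk (CoprodI.of s.val) : S.Product)).prod

/-- `w` is a word of minimal length among all words that represent the element `g`. -/
def IsShortest (g : S.Product) (w : List (Letter G)) : Prop :=
  S.eval w = g ∧ ∀ w' : List (Letter G), S.eval w' = g → w.length ≤ w'.length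

/-- A `⊥`-commutation: exchange two consecutive letters from orthogonal factors. -/
inductive PerpComm : List (Letter G) → List (Letter G) → Prop
  | swap (u v : List (Letter G)) {i j : I} (h : Oposet.Perp i j) (a : G i) (b : G j)
      (ha : a ≠ 1) (hb : b ≠ 1) :
      PerpComm (u ++ Letter.mk a ha :: Letter.mk b hb :: v)
        (u ++ Letter.mk b hb :: Letter.mk a ha :: v)

/-- A fusion: multiply two consecutive letters from the same factor (and delete the result if it
is trivial). -/
inductive Fusion : List (Letter G) → List (Letter G) → Prop
  | cancel (u v : List (Letter G)) {i : I} (a b : G i) (ha : a ≠ 1) (hb : b ≠ 1)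
      (hab : a * b = 1) :
      Fusion (u ++ Letter.mk a ha :: Letter.mk b hb :: v) (u ++ v)
  | merge (u v : List (Letter G)) {i : I} (a b : G i) (ha : a ≠ 1) (hb : b ≠ 1)
      (hab : a * b ≠ 1) :
      Fusion (u ++ Letter.mk a ha :: Letter.mk b hb :: v) (u ++ Letter.mk (a * b) hab :: v)

/-- A twisted left-commutation: replace `a b` by `b (b ∗ a)`, where `a ∈ G i`, `b ∈ G j` and
`i < j`. -/
inductive TwistedLeft : List (Letter G) → List (Letter G) → Prop
  | swap (u v : List (Letter G)) {i j : I} (h : i < j) (a : G i) (b : G j)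
      (ha : a ≠ 1) (hb : b ≠ 1) :
      TwistedLeft (u ++ Letter.mk a ha :: Letter.mk b hb :: v)
        (u ++ Letter.mk b hb :: Letter.mk (S.star h b a) (S.star_ne_one h b ha) :: v)

/-- A twisted right-commutation: replace `b a` by `(b⁻¹ ∗ a) b`, where `a ∈ G i`, `b ∈ G j` and
`i < j`. -/
inductive TwistedRight : List (Letter G) → List (Letter G) → Prop
  | swap (u v : List (Letter G)) {i j : I} (h : i < j) (a : G i) (b : G j)
      (ha : a ≠ 1) (hb : b ≠ 1) :
      TwistedRight (u ++ Letter.mk b hb :: Letter.mk a ha :: v)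
        (u ++ Letter.mk (S.star h b⁻¹ a) (S.star_ne_one h b⁻¹ ha) :: Letter.mk b hb :: v)

/-- A single `⊥`-commutation or twisted (left- or right-) commutation. -/
def Commutation (w w' : List (Letter G)) : Prop :=
  PerpComm w w' ∨ S.TwistedLeft w w' ∨ S.TwistedRight w w'

/-- A single `⊥`-commutation, fusion or twisted commutation. -/
def Move (w w' : List (Letter G)) : Prop :=
  S.Commutation w w' ∨ Fusion w w'

/-- A word is `𝔔`-reduced if no finite sequence of `⊥`-commutations, fusions and twisted
commutations turns it into a shorter word. -/
def IsReduced (w : List (Letter G)) : Prop :=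
  ∀ w' : List (Letter G), Relation.ReflTransGen S.Move w w' → w.length ≤ w'.length

end QuandleSystem

namespace Letter

variable {I : Type*} {G : I → Type*} [∀ i, Group (G i)]

/-! Let 𝔔 act on words modulo commutations (traces) so that a reduced word carries the empty trace
to its own class (`IsReduced.traceAction_eval`). Reduced words for the same element are then related
by commutations, so they have equal length. Moves preserve the element, so shortest words are
reduced, and both claims follow.

An element of `G i` acts on a trace without hidden fusions (`Trace.Red`) by extracting a possibly
trivial leading factor from `G i` and multiplying it; all other traces are fixed. This is well
defined because the extraction is unique, which rests on `Trace.cons_eq_cons`: two different leading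
letters of one trace must swap past each other. That lemma comes from `hexagon`, a Yang–Baxter
property of swaps which encodes the quandle relation. The defining relations of 𝔔 are checked in
`act_act_of_perp` and `act_act_of_lt`; both reduce to `not_head_act_and_act_consG`. -/

theorem eq_of_sigma_eq {a b : Letter G} (h : (⟨a.idx, a.val⟩ : Σ i, G i) = ⟨b.idx, b.val⟩) :
    a = b := by
  obtain ⟨a, ha⟩ := a
  obtain ⟨b, hb⟩ := b
  cases h
  rfl

/-- The index of the first letter is smaller than, or orthogonal to, that of the second. -/
def Below [Oposet I] (a b : Letter G) : Prop :=
  a.idx < b.idx ∨ Oposet.Perp a.idx b.idx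

end Letter

/-! ### Orthogonality, order and the star operation on letters -/

namespace QuandleSystem

open Monoid (CoprodI)

variable {I : Type*} [Oposet I] {G : I → Type*} [∀ i, Group (G i)] (S : QuandleSystem I G)

theorem not_perp_of_lt {i j : I} (h : i < j) : ¬ Oposet.Perp i j := fun hp =>
  (Oposet.not_comparable_of_perp i j hp).1 h.le

theorem perp_of_perp_of_lt {i j k : I} (h : Oposet.Perp i j) (hk : k < j) : Oposet.Perp i k :=
  Oposet.perp_symm _ _ (Oposet.perp_of_le_of_perp _ _ _ hk.le (Oposet.perp_symm _ _ h))

theorem perp_of_lt_of_perp {i j k : I} (hk : k < i) (h : Oposet.Perp i j) : Oposet.Perp k j :=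
  Oposet.perp_of_le_of_perp _ _ _ hk.le h

theorem not_perp_of_gt {i j : I} (h : j < i) : ¬ Oposet.Perp i j := fun hp =>
  (Oposet.not_comparable_of_perp i j hp).2 h.le

theorem app_app_inv {j : I} (b : G j) (x : Σ i : Set.Iio j, G i) :
    (S.act b).app ((S.act b⁻¹).app x) = x := by
  rw [← S.act_mul, inv_mul_cancel, S.act_one]

theorem app_inv_app {j : I} (b : G j) (x : Σ i : Set.Iio j, G i) :
    (S.act b⁻¹).app ((S.act b).app x) = x := by
  rw [← S.act_mul, mul_inv_cancel, S.act_one]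

theorem obj_inv_obj {j : I} (b : G j) (x : Set.Iio j) :
    (S.act b⁻¹).obj ((S.act b).obj x) = x :=
  congrArg Sigma.fst (S.app_inv_app b ⟨x, 1⟩)

open Classical in
/-- The letter `b ∗ a` if `a.idx < b.idx`, and the letter `a` otherwise. -/
noncomputable def lstar (b a : Letter G) : Letter G :=
  if h : a.idx < b.idx then ⟨S.star h b.val a.val, S.star_ne_one h b.val a.ne_one⟩ else a

theorem lstar_of_lt {a b : Letter G} (h : a.idx < b.idx) :
    S.lstar b a = ⟨S.star h b.val a.val, S.star_ne_one h b.val a.ne_one⟩ := dif_pos h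

theorem lstar_of_perp {a b : Letter G} (h : Oposet.Perp a.idx b.idx) : S.lstar b a = a :=
  dif_neg fun h' => not_perp_of_lt h' h

theorem lstar_of_perp' {a b : Letter G} (h : Oposet.Perp b.idx a.idx) : S.lstar b a = a :=
  S.lstar_of_perp (Oposet.perp_symm _ _ h)

theorem lstar_idx_of_lt {a b : Letter G} (h : a.idx < b.idx) :
    (S.lstar b a).idx = ((S.act b.val).obj ⟨a.idx, h⟩).1 := by
  rw [S.lstar_of_lt h]; rfl

theorem lstar_idx_lt {a b : Letter G} (h : a.idx < b.idx) : (S.lstar b a).idx < b.idx := by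
  rw [S.lstar_idx_of_lt h]; exact ((S.act b.val).obj ⟨a.idx, h⟩).2

theorem lstar_idx_congr {a a' b : Letter G} (h : a.idx = a'.idx) :
    (S.lstar b a).idx = (S.lstar b a').idx := by
  obtain ⟨a, ha⟩ := a
  obtain ⟨a', ha'⟩ := a'
  dsimp only at h
  subst h
  unfold lstar
  dsimp only
  split_ifs <;> rfl

theorem lstar_lt_iff {a b c : Letter G} (ha : a.idx < c.idx) (hb : b.idx < c.idx) :
    (S.lstar c a).idx < (S.lstar c b).idx ↔ a.idx < b.idx := by
  have key : ∀ (g : G c.idx) (x y : Set.Iio c.idx), x.1 < y.1 →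
      ((S.act g).obj x).1 < ((S.act g).obj y).1 := fun g x y h =>
    S.starIdx_lt_starIdx h y.2 g
  rw [S.lstar_idx_of_lt ha, S.lstar_idx_of_lt hb]
  refine ⟨fun h => ?_, key c.val ⟨_, ha⟩ ⟨_, hb⟩⟩
  have := key c.val⁻¹ _ _ h
  rwa [obj_inv_obj, obj_inv_obj] at this

theorem lstar_perp_iff {a b c : Letter G} (ha : a.idx < c.idx) (hb : b.idx < c.idx) :
    Oposet.Perp (S.lstar c a).idx (S.lstar c b).idx ↔ Oposet.Perp a.idx b.idx := by
  rw [S.lstar_idx_of_lt ha, S.lstar_idx_of_lt hb]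
  refine ⟨fun h => ?_, S.act_perp _ _ ⟨_, ha⟩ ⟨_, hb⟩⟩
  have := S.act_perp _ c.val⁻¹ _ _ h
  rwa [obj_inv_obj, obj_inv_obj] at this

theorem lstar_injective_of_lt {a b c : Letter G} (ha : a.idx < c.idx) (hb : b.idx < c.idx)
    (h : S.lstar c a = S.lstar c b) : a = b := by
  rw [S.lstar_of_lt ha, S.lstar_of_lt hb] at h
  have key : (S.act c.val).app ⟨⟨a.idx, ha⟩, a.val⟩ = (S.act c.val).app ⟨⟨b.idx, hb⟩, b.val⟩ := by
    have h1 := congrArg (fun l : Letter G => (⟨l.idx, l.val⟩ : Σ i, G i)) h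
    have inj : Function.Injective
        (fun x : Σ i : Set.Iio c.idx, G i => (⟨x.1.1, x.2⟩ : Σ i, G i)) := by
      rintro ⟨⟨i, hi⟩, x⟩ ⟨⟨j, hj⟩, y⟩ hxy
      cases hxy
      rfl
    exact inj h1
  have h2 := congrArg (S.act c.val⁻¹).app key
  rw [app_inv_app, app_inv_app] at h2
  exact Letter.eq_of_sigma_eq
    (congrArg (fun x : Σ i : Set.Iio c.idx, G i => (⟨x.1.1, x.2⟩ : Σ i, G i)) h2)

theorem lstar_star_inv {a b : Letter G} (h : a.idx < b.idx) :
    S.lstar b ⟨S.star h b.val⁻¹ a.val, S.star_ne_one h b.val⁻¹ a.ne_one⟩ = a := by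
  rw [S.lstar_of_lt (S.starIdx_lt h b.val⁻¹)]
  exact Letter.eq_of_sigma_eq
    (congrArg (fun x : Σ i : Set.Iio b.idx, G i => (⟨x.1.1, x.2⟩ : Σ i, G i))
      (S.app_app_inv b.val ⟨⟨a.idx, h⟩, a.val⟩))

theorem lstar_lstar {a b c : Letter G} (hab : a.idx < b.idx) (hbc : b.idx < c.idx) :
    S.lstar c (S.lstar b a) = S.lstar (S.lstar c b) (S.lstar c a) := by
  have h1 := (S.lstar_idx_lt hab).trans hbc
  have h2 := (S.lstar_lt_iff (hab.trans hbc) hbc).2 hab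
  rw [S.lstar_of_lt h1, S.lstar_of_lt h2]
  apply Letter.eq_of_sigma_eq
  have := S.quandle _ _ _ hab hbc a.val b.val c.val
  have e1 := S.lstar_of_lt hab
  have e2 := S.lstar_of_lt hbc
  have e3 := S.lstar_of_lt (hab.trans hbc)
  revert h1 h2
  rw [e1, e2, e3]
  intro h1 h2
  exact this

variable {S}

theorem lstar_below {a b : Letter G} (h : a.Below b) : (S.lstar b a).Below b := by
  rcases h with h | h
  · exact Or.inl (S.lstar_idx_lt h)
  · rw [S.lstar_of_perp h]; exact Or.inr h

theorem lstar_below_iff {a b c : Letter G} (h : a.Below b) (hb : b.Below c) :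
    (S.lstar b a).Below c ↔ a.Below c := by
  rcases h with h | h
  · rcases hb with hb | hb
    · exact iff_of_true (Or.inl ((S.lstar_idx_lt h).trans hb)) (Or.inl (h.trans hb))
    · exact iff_of_true (Or.inr (perp_of_lt_of_perp (S.lstar_idx_lt h) hb))
        (Or.inr (perp_of_lt_of_perp h hb))
  · rw [S.lstar_of_perp h]

theorem lstar_below_lstar_iff {a b c : Letter G} (ha : a.Below c) (hb : b.Below c) :
    (S.lstar c a).Below (S.lstar c b) ↔ a.Below b := by
  rcases ha with ha | ha <;> rcases hb with hb | hb
  · exact or_congr (S.lstar_lt_iff ha hb) (S.lstar_perp_iff ha hb)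
  · rw [S.lstar_of_perp hb]
    have hb' := Oposet.perp_symm _ _ hb
    exact iff_of_true (Or.inr (perp_of_lt_of_perp (S.lstar_idx_lt ha) hb'))
      (Or.inr (perp_of_lt_of_perp ha hb'))
  · rw [S.lstar_of_perp ha]
    exact iff_of_true (Or.inr (perp_of_perp_of_lt ha (S.lstar_idx_lt hb)))
      (Or.inr (perp_of_perp_of_lt ha hb))
  · rw [S.lstar_of_perp ha, S.lstar_of_perp hb]

/-- Orthogonality passes to smaller indices, so every star outside the chain `a < b < c` that could
spoil the quandle relation is trivial. The hypothesis `hac` does not follow from the others when `a`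
and `b` are orthogonal. -/
theorem lstar_lstar_of_below {a b c : Letter G} (hab : a.Below b) (hbc : b.Below c)
    (hac : a.Below c) :
    S.lstar c (S.lstar b a) = S.lstar (S.lstar c b) (S.lstar c a) := by
  rcases hab with hab | hab
  · rcases hbc with hbc | hbc
    · exact S.lstar_lstar hab hbc
    · rw [S.lstar_of_perp hbc, S.lstar_of_perp (perp_of_lt_of_perp hab hbc),
        S.lstar_of_perp (perp_of_lt_of_perp (S.lstar_idx_lt hab) hbc)]
  · rw [S.lstar_of_perp hab]
    rcases hac with hac | hac
    · rcases hbc with hbc | hbc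
      · rw [S.lstar_of_perp ((S.lstar_perp_iff hac hbc).2 hab)]
      · rw [S.lstar_of_perp hbc, S.lstar_of_perp
          (perp_of_lt_of_perp (S.lstar_idx_lt hac) (Oposet.perp_symm _ _ hbc))]
    · rw [S.lstar_of_perp hac]
      rcases hbc with hbc | hbc
      · rw [S.lstar_of_perp (perp_of_perp_of_lt hac (S.lstar_idx_lt hbc))]
      · rw [S.lstar_of_perp hbc, S.lstar_of_perp hab]

theorem perp_of_below_of_below {a b a' b' : Letter G} (h : a.Below b) (h' : b'.Below a')
    (ha : a'.idx = a.idx) (hb : b'.idx = b.idx) : Oposet.Perp a.idx b.idx := by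
  rcases h with h | h
  · exfalso
    rcases h' with h' | h' <;> rw [ha, hb] at h'
    · exact lt_asymm h h'
    · exact not_perp_of_gt h h'
  · exact h

theorem not_below_self {a b : Letter G} (h : a.Below b) : a.idx ≠ b.idx := fun e => by
  rcases h with h | h <;> rw [e] at h
  · exact lt_irrefl _ h
  · exact Oposet.perp_irrefl _ h

/-! ### Swaps of two letters -/

variable (S)

/-- The two-letter word `a b` becomes `c d` by moving `a` to the right past `b`, where `a` is below
`b`. -/
def SwapLeft (a b c d : Letter G) : Prop :=
  a.Below b ∧ c = b ∧ d = S.lstar b a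

/-- The two-letter word `a b` becomes `c d` by a single commutation. -/
def Swap (a b c d : Letter G) : Prop :=
  S.SwapLeft a b c d ∨ S.SwapLeft c d a b

variable {S}

theorem Swap.symm {a b c d : Letter G} (h : S.Swap a b c d) : S.Swap c d a b := Or.symm h

theorem SwapLeft.symm_of_perp {a b c d : Letter G} (h : S.SwapLeft a b c d)
    (hp : Oposet.Perp a.idx b.idx) : S.SwapLeft c d a b := by
  obtain ⟨-, rfl, rfl⟩ := h
  rw [S.lstar_of_perp hp]
  have hp' := Oposet.perp_symm _ _ hp
  exact ⟨Or.inr hp', rfl, (S.lstar_of_perp hp').symm⟩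

theorem lstar_injective_of_below {a b c : Letter G} (ha : a.Below c) (hb : b.Below c)
    (h : S.lstar c a = S.lstar c b) : a = b := by
  rcases ha with ha | ha <;> rcases hb with hb | hb
  · exact S.lstar_injective_of_lt ha hb h
  · rw [S.lstar_of_perp hb] at h
    exact absurd hb (h ▸ not_perp_of_lt (S.lstar_idx_lt ha))
  · rw [S.lstar_of_perp ha] at h
    exact absurd ha (h ▸ not_perp_of_lt (S.lstar_idx_lt hb))
  · rwa [S.lstar_of_perp ha, S.lstar_of_perp hb] at h

theorem SwapLeft.unique {a b c d c' d' : Letter G} (h : S.SwapLeft a b c d)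
    (h' : S.Swap a b c' d') : c = c' ∧ d = d' := by
  rcases h' with h' | h'
  · exact ⟨h.2.1.trans h'.2.1.symm, h.2.2.trans h'.2.2.symm⟩
  · obtain ⟨hab, rfl, rfl⟩ := h
    obtain ⟨hcd, rfl, rfl⟩ := h'
    have hp := perp_of_below_of_below hab (lstar_below hcd) rfl rfl
    have e := lstar_injective_of_below hcd (lstar_below hcd) (S.lstar_of_perp' hp).symm
    exact ⟨e.symm, S.lstar_of_perp hp⟩

/-- A pair that can be swapped in both directions is orthogonal, and then both swaps are the plain
exchange; in a single direction, uniqueness is injectivity of the star. So a swap is a partial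
involution on pairs. -/
theorem Swap.unique {a b c d c' d' : Letter G} (h : S.Swap a b c d) (h' : S.Swap a b c' d') :
    c = c' ∧ d = d' := by
  rcases h with h | h
  · exact h.unique h'
  · rcases h' with h' | h'
    · exact (h'.unique (Or.inr h)).imp Eq.symm Eq.symm
    · obtain ⟨hcd, rfl, rfl⟩ := h
      obtain ⟨hcd', rfl, e⟩ := h'
      exact ⟨lstar_injective_of_below hcd hcd' e, rfl⟩

theorem Swap.idx_ne {a b c d : Letter G} (h : S.Swap a b c d) : a.idx ≠ c.idx := by
  rcases h with h | h
  · obtain ⟨h, rfl, -⟩ := h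
    exact not_below_self h
  · obtain ⟨h, rfl, -⟩ := h
    exact (not_below_self h).symm

theorem Swap.idx_ne_right {a b c d : Letter G} (h : S.Swap a b c d) : a.idx ≠ b.idx := by
  rcases h with ⟨h, -, -⟩ | ⟨h, rfl, rfl⟩
  · exact not_below_self h
  · exact (not_below_self (lstar_below h)).symm

theorem exists_lstar_eq {x y z : Letter G} (h : y.Below x) (hz : z.idx = (S.lstar x y).idx) :
    ∃ z₀ : Letter G, z₀.idx = y.idx ∧ z₀.Below x ∧ S.lstar x z₀ = z := by
  rcases h with h | h
  · have hzx : z.idx < x.idx := hz ▸ S.lstar_idx_lt h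
    refine ⟨_, ?_, Or.inl (S.starIdx_lt hzx x.val⁻¹), S.lstar_star_inv hzx⟩
    rw [S.lstar_idx_of_lt h] at hz
    have := S.obj_inv_obj x.val ⟨y.idx, h⟩
    have e : (⟨z.idx, hzx⟩ : Set.Iio x.idx) = (S.act x.val).obj ⟨y.idx, h⟩ := Subtype.ext hz
    rw [← e] at this
    exact congrArg Subtype.val this
  · rw [S.lstar_of_perp h] at hz
    have hzx : Oposet.Perp z.idx x.idx := hz ▸ h
    exact ⟨z, hz, Or.inr hzx, S.lstar_of_perp hzx⟩

theorem below_congr {a b a' b' : Letter G} (h : a.Below b) (ha : a'.idx = a.idx)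
    (hb : b'.idx = b.idx) : a'.Below b' := by
  unfold Letter.Below
  rwa [ha, hb]

/-- If `x` passes a letter with the same index as `z`, then its image can pass `z`. -/
theorem Swap.exists_of_idx_eq {x y' y x' z : Letter G} (h : S.Swap x y' y x')
    (hz : z.idx = y'.idx) : ∃ z' x'', S.Swap x' z z' x'' ∧ z'.idx = y.idx := by
  rcases h with ⟨h, rfl, rfl⟩ | ⟨h, rfl, rfl⟩
  · exact ⟨z, _, Or.inl ⟨below_congr (lstar_below h) rfl hz, rfl, rfl⟩, hz⟩
  · obtain ⟨z₀, hz₀, hzx, e⟩ := exists_lstar_eq h hz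
    exact ⟨z₀, x, Or.inr ⟨hzx, rfl, e.symm⟩, hz₀⟩

/-- In `x y' z'`, if `z'` can pass `y'` and arrive in the factor of `x`, then after `x` has passed
`y'` it stands next to `z'` in a common factor: fusibility does not depend on which letter travels.
-/
theorem Swap.idx_eq {x y' y x' z z' y'' : Letter G} (h : S.Swap x y' y x')
    (h' : S.Swap y' z' z y'') (hz : z.idx = x.idx) : z'.idx = x'.idx := by
  rcases h with ⟨h, rfl, rfl⟩ | ⟨h, rfl, rfl⟩ <;> rcases h' with ⟨h', rfl, rfl⟩ | ⟨h', e, rfl⟩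
  · have hp := perp_of_below_of_below h h' hz rfl
    rw [S.lstar_of_perp hp, hz]
  · subst e; exact S.lstar_idx_congr hz
  · exact hz
  · subst e
    have hp := perp_of_below_of_below (lstar_below h) (below_congr h' hz.symm rfl) rfl rfl
    rw [← hz] at hp
    rw [S.lstar_of_perp' hp, hz]

theorem Swap.idx_eq_of_below {c z z' c' : Letter G} (h : S.Swap c z' z c') (hc : c.Below z) :
    z'.idx = z.idx := by
  rcases h with ⟨-, rfl, -⟩ | ⟨h, rfl, rfl⟩
  · rfl
  · rw [S.lstar_of_perp' (perp_of_below_of_below hc h rfl rfl)]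

variable (S) in
/-- The other side of the hexagon which completes the three swaps `x y₁ z₂ → y x₁ z₂ → y z x₂ →
z' y' x₂`. -/
def HexagonSide (x y₁ z₂ z' y' x₂ : Letter G) : Prop :=
  ∃ z₃ y₂ x₃, S.Swap y₁ z₂ z₃ y₂ ∧ S.Swap x z₃ z' x₃ ∧ S.Swap x₃ y₂ y' x₂

theorem HexagonSide.symm {x y₁ z₂ z' y' x₂ : Letter G} (h : S.HexagonSide x y₁ z₂ z' y' x₂) :
    S.HexagonSide z' y' x₂ x y₁ z₂ := by
  obtain ⟨z₃, y₂, x₃, h₁, h₂, h₃⟩ := h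
  exact ⟨x₃, y₂, z₃, h₃.symm, h₂.symm, h₁.symm⟩

/-! ### The hexagon for swaps of three letters -/

section Hexagon

variable {x y₁ y x₁ z₂ z x₂ z' y' : Letter G}

/-- The suffix gives the directions of the three swaps: `l` for `SwapLeft`, `r` for its inverse. The
two sides of the hexagon meet because of the quandle relation. -/
theorem hexagon_lll (h₁ : S.SwapLeft x y₁ y x₁) (h₂ : S.SwapLeft x₁ z₂ z x₂)
    (h₃ : S.SwapLeft y z z' y') : S.HexagonSide x y₁ z₂ z' y' x₂ := by
  obtain ⟨h₁, rfl, rfl⟩ := h₁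
  obtain ⟨h₂, rfl, rfl⟩ := h₂
  obtain ⟨h₃, rfl, rfl⟩ := h₃
  have hxz := (lstar_below_iff h₁ h₃).1 h₂
  exact ⟨_, _, _, Or.inl ⟨h₃, rfl, rfl⟩, Or.inl ⟨hxz, rfl, rfl⟩,
    Or.inl ⟨(lstar_below_lstar_iff hxz h₃).2 h₁, rfl, lstar_lstar_of_below h₁ h₃ hxz⟩⟩

theorem hexagon_llr (h₁ : S.SwapLeft x y₁ y x₁) (h₂ : S.SwapLeft x₁ z₂ z x₂)
    (h₃ : S.SwapLeft z' y' y z) : S.HexagonSide x y₁ z₂ z' y' x₂ := by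
  obtain ⟨h₁, rfl, rfl⟩ := h₁
  obtain ⟨h₂, rfl, rfl⟩ := h₂
  obtain ⟨h₃, rfl, rfl⟩ := h₃
  have hxz := (lstar_below_lstar_iff h₁ h₃).1 h₂
  exact ⟨_, _, _, Or.inr ⟨h₃, rfl, rfl⟩, Or.inl ⟨hxz, rfl, rfl⟩,
    Or.inl ⟨(lstar_below_iff hxz h₃).2 h₁, rfl, (lstar_lstar_of_below hxz h₃ h₁).symm⟩⟩

theorem hexagon_rll (h₁ : S.SwapLeft y x₁ x y₁) (h₂ : S.SwapLeft x₁ z₂ z x₂)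
    (h₃ : S.SwapLeft y z z' y') : S.HexagonSide x y₁ z₂ z' y' x₂ := by
  obtain ⟨h₁, rfl, rfl⟩ := h₁
  obtain ⟨h₂, rfl, rfl⟩ := h₂
  obtain ⟨h₃, rfl, rfl⟩ := h₃
  exact ⟨_, _, _, Or.inl ⟨(lstar_below_iff h₁ h₂).2 h₃, rfl, rfl⟩, Or.inl ⟨h₂, rfl, rfl⟩,
    Or.inr ⟨(lstar_below_lstar_iff h₃ h₂).2 h₁, rfl, lstar_lstar_of_below h₁ h₂ h₃⟩⟩

/-- With strict inequalities throughout, the indices would satisfy `z < x₁ < y < z`. So one swap is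
between orthogonal letters, and reversing its direction leads to another case. -/
theorem hexagon_lrl (h₁ : S.SwapLeft x y₁ y x₁) (h₂ : S.SwapLeft z x₂ x₁ z₂)
    (h₃ : S.SwapLeft y z z' y') : S.HexagonSide x y₁ z₂ z' y' x₂ := by
  have hp : Oposet.Perp x.idx y₁.idx ∨ Oposet.Perp z.idx x₂.idx ∨ Oposet.Perp y.idx z.idx := by
    obtain ⟨h₁, rfl, rfl⟩ := h₁
    obtain ⟨h₂, rfl, rfl⟩ := h₂
    obtain ⟨h₃, rfl, rfl⟩ := h₃
    rcases h₁ with h₁ | h₁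
    · rcases h₂ with h₂ | h₂
      · rcases h₃ with h₃ | h₃
        · exact absurd (h₂.trans (S.lstar_idx_lt h₁)) (lt_asymm h₃)
        · exact Or.inr (Or.inr h₃)
      · exact Or.inr (Or.inl h₂)
    · exact Or.inl h₁
  rcases hp with hp | hp | hp
  · exact (hexagon_rll h₃ h₂ (h₁.symm_of_perp hp)).symm
  · exact hexagon_lll h₁ (h₂.symm_of_perp hp) h₃
  · exact (hexagon_llr (h₃.symm_of_perp hp) h₂ h₁).symm

/-- Traversing the hexagon backwards reverses the order and the directions of the swaps, which pairs
the eight cases into four. -/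
theorem hexagon (h₁ : S.Swap x y₁ y x₁) (h₂ : S.Swap x₁ z₂ z x₂) (h₃ : S.Swap y z z' y') :
    S.HexagonSide x y₁ z₂ z' y' x₂ := by
  rcases h₁ with h₁ | h₁ <;> rcases h₂ with h₂ | h₂ <;> rcases h₃ with h₃ | h₃
  · exact hexagon_lll h₁ h₂ h₃
  · exact hexagon_llr h₁ h₂ h₃
  · exact hexagon_lrl h₁ h₂ h₃
  · exact (hexagon_llr h₃ h₂ h₁).symm
  · exact hexagon_rll h₁ h₂ h₃
  · exact (hexagon_lrl h₃ h₂ h₁).symm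
  · exact (hexagon_rll h₃ h₂ h₁).symm
  · exact (hexagon_lll h₃ h₂ h₁).symm

end Hexagon

end QuandleSystem

/-! ### Words up to commutations -/

namespace QuandleSystem

open Monoid (CoprodI)

variable {I : Type*} [Oposet I] {G : I → Type*} [∀ i, Group (G i)] (S : QuandleSystem I G)

/-- Replaces the three kinds of commutation by one symmetric relation on pairs of letters. -/
theorem commutation_iff {w w' : List (Letter G)} : S.Commutation w w' ↔
    ∃ u v a b c d, S.Swap a b c d ∧ w = u ++ a :: b :: v ∧ w' = u ++ c :: d :: v := by
  constructor
  · rintro (h | h | h)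
    · obtain ⟨u, v, h, a, b, ha, hb⟩ := h
      exact ⟨u, v, _, _, _, _, Or.inl ⟨Or.inr h, rfl, rfl⟩, rfl, by rw [S.lstar_of_perp h]⟩
    · obtain ⟨u, v, h, a, b, ha, hb⟩ := h
      exact ⟨u, v, _, _, _, _, Or.inl ⟨Or.inl h, rfl, rfl⟩, rfl, by rw [S.lstar_of_lt h]⟩
    · obtain ⟨u, v, h, a, b, ha, hb⟩ := h
      exact ⟨u, v, ⟨b, hb⟩, ⟨a, ha⟩, _, _,
        Or.inr ⟨Or.inl (S.starIdx_lt h b⁻¹), rfl,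
          (S.lstar_star_inv (a := ⟨a, ha⟩) (b := ⟨b, hb⟩) h).symm⟩, rfl, rfl⟩
  · rintro ⟨u, v, a, b, c, d, h, rfl, rfl⟩
    rcases h with ⟨h | h, rfl, rfl⟩ | ⟨h | h, rfl, rfl⟩
    · rw [S.lstar_of_lt h]
      exact Or.inr (Or.inl ⟨u, v, h, a.val, c.val, a.ne_one, c.ne_one⟩)
    · rw [S.lstar_of_perp h]
      exact Or.inl ⟨u, v, h, a.val, c.val, a.ne_one, c.ne_one⟩
    · refine Or.inr (Or.inr ?_)
      have h' := S.lstar_idx_lt h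
      have := TwistedRight.swap (S := S) u v h' (S.lstar a c).val a.val (S.lstar a c).ne_one
        a.ne_one
      have e : (⟨S.star h' a.val⁻¹ (S.lstar a c).val,
          S.star_ne_one h' a.val⁻¹ (S.lstar a c).ne_one⟩ : Letter G) = c :=
        S.lstar_injective_of_lt (S.starIdx_lt h' a.val⁻¹) h (S.lstar_star_inv h')
      rwa [e] at this
    · rw [S.lstar_of_perp h]
      exact Or.inl ⟨u, v, Oposet.perp_symm _ _ h, a.val, c.val, a.ne_one, c.ne_one⟩

variable {S}

theorem Commutation.symm {w w' : List (Letter G)} (h : S.Commutation w w') :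
    S.Commutation w' w := by
  rw [commutation_iff] at h ⊢
  obtain ⟨u, v, a, b, c, d, h, rfl, rfl⟩ := h
  exact ⟨u, v, c, d, a, b, h.symm, rfl, rfl⟩

theorem Commutation.cons {w w' : List (Letter G)} (x : Letter G) (h : S.Commutation w w') :
    S.Commutation (x :: w) (x :: w') := by
  rw [commutation_iff] at h ⊢
  obtain ⟨u, v, a, b, c, d, h, rfl, rfl⟩ := h
  exact ⟨x :: u, v, a, b, c, d, h, rfl, rfl⟩

theorem Commutation.length_eq {w w' : List (Letter G)} (h : S.Commutation w w') :
    w.length = w'.length := by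
  rw [commutation_iff] at h
  obtain ⟨u, v, a, b, c, d, h, rfl, rfl⟩ := h
  simp

/-- A commutation takes place either in the tail or at the first two letters. -/
theorem Commutation.cases_cons {x : Letter G} {t w : List (Letter G)}
    (h : S.Commutation (x :: t) w) : (∃ t', S.Commutation t t' ∧ w = x :: t') ∨
      ∃ y x' y' t', S.Swap x y y' x' ∧ t = y :: t' ∧ w = y' :: x' :: t' := by
  rw [commutation_iff] at h
  obtain ⟨u, v, a, b, c, d, h, e, rfl⟩ := h
  cases u with
  | nil =>
    obtain ⟨rfl, rfl⟩ := List.cons_eq_cons.1 e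
    exact Or.inr ⟨b, d, c, v, h, rfl, rfl⟩
  | cons z u =>
    obtain ⟨rfl, rfl⟩ := List.cons_eq_cons.1 e
    exact Or.inl ⟨_, (S.commutation_iff).2 ⟨u, v, a, b, c, d, h, rfl, rfl⟩, rfl⟩

variable (S)

instance : Std.Symm S.Commutation := ⟨fun _ _ => .symm⟩

/-- Two words are equivalent if they are related by a finite sequence of commutations. -/
def commSetoid : Setoid (List (Letter G)) where
  r := Relation.ReflTransGen S.Commutation
  iseqv := ⟨fun _ => .refl, fun h => symm h,
    .trans⟩

/-- Words up to commutations. -/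
def Trace : Type _ := Quotient S.commSetoid

variable {S}

/-- The class of a word. -/
def Trace.mk (w : List (Letter G)) : S.Trace := Quotient.mk S.commSetoid w

theorem Trace.mk_eq_mk {w w' : List (Letter G)} :
    (Trace.mk w : S.Trace) = Trace.mk w' ↔ Relation.ReflTransGen S.Commutation w w' :=
  Quotient.eq (r := S.commSetoid)

/-- Put a letter in front of a word up to commutations. -/
def Trace.cons (x : Letter G) : S.Trace → S.Trace :=
  Quotient.map' (List.cons x) fun _ _ h => Relation.ReflTransGen.lift (List.cons x) (fun _ _ => Commutation.cons x) _ _ h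

theorem Trace.cons_mk (x : Letter G) (w : List (Letter G)) :
    (Trace.cons x (Trace.mk w) : S.Trace) = Trace.mk (x :: w) := rfl

theorem Trace.cons_cons {x y y' x' : Letter G} (h : S.Swap x y y' x') (t : S.Trace) :
    Trace.cons x (Trace.cons y t) = Trace.cons y' (Trace.cons x' t) := by
  induction t using Quotient.inductionOn with
  | h w => exact Trace.mk_eq_mk.2 (.single ((S.commutation_iff).2
      ⟨[], w, x, y, y', x', h, rfl, rfl⟩))

theorem length_eq_of_reflTransGen {w w' : List (Letter G)}
    (h : Relation.ReflTransGen S.Commutation w w') : w.length = w'.length := by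
  induction h with
  | refl => rfl
  | tail _ h ih => exact ih.trans h.length_eq

/-- Outer induction on the length, inner induction on the chain of commutations. Only a last
commutation at the front is serious: its previous leading letter `z` is compared with `x` by the
inner hypothesis, and the tails behind `z` by the outer one. -/
theorem Trace.mk_cons_eq_mk_cons (n : ℕ) : ∀ {x y : Letter G} {t s : List (Letter G)},
    t.length = n → Relation.ReflTransGen S.Commutation (x :: t) (y :: s) →
    (x = y ∧ (Trace.mk t : S.Trace) = Trace.mk s) ∨ ∃ y' x' v, (Trace.mk t : S.Trace) =
      Trace.mk (y' :: v) ∧ (Trace.mk s : S.Trace) = Trace.mk (x' :: v) ∧ S.Swap x y' y x' := by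
  induction n with
  | zero =>
    intro x y t s ht h
    obtain rfl := List.length_eq_zero_iff.1 ht
    generalize e : y :: s = w at h
    have key : w = [x] := by
      clear e
      induction h with
      | refl => rfl
      | tail _ h ih =>
        subst ih
        rcases h.cases_cons with ⟨t', h', rfl⟩ | ⟨_, _, _, _, _, h', _⟩
        · rw [List.length_eq_zero_iff.1 (show t'.length = 0 from h'.length_eq.symm)]
        · cases h'
    subst e
    obtain ⟨rfl, rfl⟩ := List.cons_eq_cons.1 key
    exact Or.inl ⟨rfl, rfl⟩
  | succ n ih =>
    intro x y t s ht h
    generalize e : y :: s = w at h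
    induction h generalizing y s with
    | refl =>
      obtain ⟨rfl, rfl⟩ := List.cons_eq_cons.1 e
      exact Or.inl ⟨rfl, rfl⟩
    | @tail w₁ w₂ h₁ h ih' =>
      subst e
      rcases h.symm.cases_cons with ⟨s', hs, rfl⟩ | ⟨z', y', z, s', hs, rfl, rfl⟩
      · have hs' : (Trace.mk s : S.Trace) = Trace.mk s' := Trace.mk_eq_mk.2 (.single hs)
        rw [hs']
        exact ih' rfl
      · have hlen := length_eq_of_reflTransGen h₁
        rcases ih' rfl with ⟨rfl, e⟩ | ⟨y₁, x₁, v, e₁, e₂, hx⟩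
        · exact Or.inr ⟨y', z', s', e, rfl, hs.symm⟩
        · have hs'n : s'.length = n := by simpa [ht] using hlen.symm
          rcases ih hs'n (Trace.mk_eq_mk.1 e₂) with ⟨rfl, e₃⟩ | ⟨x₂, z₂, r, e₃, e₄, hz⟩
          · obtain ⟨rfl, rfl⟩ := hx.symm.unique hs.symm
            refine Or.inl ⟨rfl, ?_⟩
            rw [e₁, ← Trace.cons_mk, ← Trace.cons_mk, e₃]
          -- Now `t` is `y₁ z₂ r` and `s` is `z' x₂ r`. The hexagon replaces the route from `x` to
          -- `y` through `z` by a direct swap of `x` with `z₃`.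
          · obtain ⟨z₃, y₂, x₃, k₁, k₂, k₃⟩ := hexagon hx hz.symm hs.symm
            refine Or.inr ⟨z₃, x₃, y₂ :: r, ?_, ?_, k₂⟩
            · rw [e₁, ← Trace.cons_mk, e₄, ← Trace.cons_mk, Trace.cons_cons k₁]; rfl
            · rw [← Trace.cons_mk, e₃, ← Trace.cons_mk, Trace.cons_cons k₃.symm]; rfl

theorem Trace.cons_eq_cons {x y : Letter G} {t s : S.Trace} (h : Trace.cons x t = Trace.cons y s) :
    (x = y ∧ t = s) ∨
      ∃ y' x' v, t = Trace.cons y' v ∧ s = Trace.cons x' v ∧ S.Swap x y' y x' := by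
  induction t using Quotient.inductionOn with | h t => ?_
  induction s using Quotient.inductionOn with | h s => ?_
  rcases Trace.mk_cons_eq_mk_cons _ rfl (Trace.mk_eq_mk.1 h) with h | ⟨y', x', v, h₁, h₂, h₃⟩
  · exact Or.inl h
  · exact Or.inr ⟨y', x', Trace.mk v, h₁, h₂, h₃⟩

/-! ### Leading factors and reduced traces -/

namespace Trace

/-- `t` can be written with first letter in the factor of index `i`. -/
def Head (i : I) (t : S.Trace) : Prop :=
  ∃ (x : Letter G) (s : S.Trace), x.idx = i ∧ t = cons x s

theorem not_head_nil (i : I) : ¬ Head i (mk [] : S.Trace) := by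
  rintro ⟨x, s, -, h⟩
  induction s using Quotient.inductionOn with | h s => ?_
  exact absurd (length_eq_of_reflTransGen (mk_eq_mk.1 h)) (by simp)

/-- Words up to commutations in which no letter can be moved to the left so as to meet a letter of
the same index. -/
inductive Red : S.Trace → Prop
  | nil : Red (mk [])
  | cons {x : Letter G} {s : S.Trace} : Red s → ¬ Head x.idx s → Red (cons x s)

theorem head_of_head_cons {x y' y x' : Letter G} (h : S.Swap x y' y x') {v : S.Trace}
    (hv : Head y'.idx v) : Head y.idx (Trace.cons x' v) := by
  obtain ⟨z, u, hz, rfl⟩ := hv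
  obtain ⟨z', x'', h', e⟩ := h.exists_of_idx_eq hz
  exact ⟨z', Trace.cons x'' u, e, cons_cons h' u⟩

/-- `Red` refers to one spelling of the trace; this makes it available for every choice of leading
letter. -/
theorem Red.of_cons {t : S.Trace} (ht : Red t) : ∀ {x : Letter G} {s : S.Trace},
    t = Trace.cons x s → Red s ∧ ¬ Head x.idx s := by
  induction ht with
  | nil => intro x s h; exact absurd ⟨x, s, rfl, h⟩ (not_head_nil x.idx)
  | @cons y s' hs' hy ih =>
    intro x s h
    rcases cons_eq_cons h.symm with ⟨rfl, rfl⟩ | ⟨y', x', v, rfl, rfl, hx⟩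
    · exact ⟨hs', hy⟩
    · obtain ⟨hv, hx'⟩ := ih rfl
      refine ⟨.cons hv fun hh => hy (head_of_head_cons hx hh), ?_⟩
      rintro ⟨z, u, hz, e⟩
      rcases cons_eq_cons e with ⟨rfl, -⟩ | ⟨z', y'', r, rfl, -, h'⟩
      · exact hx.idx_ne_right hz.symm
      · exact hx' ⟨z', r, hx.idx_eq h' hz, rfl⟩

end Trace
end QuandleSystem

namespace QuandleSystem

open Monoid (CoprodI)

variable {I : Type*} [Oposet I] {G : I → Type*} [∀ i, Group (G i)] {S : QuandleSystem I G}

/-! ### The action of a single factor on traces -/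

namespace Trace

open Classical in
/-- Put an element of a factor, possibly trivial, in front of a word up to commutations. -/
noncomputable def consG {i : I} (a : G i) (t : S.Trace) : S.Trace :=
  if h : a = 1 then t else cons ⟨a, h⟩ t

theorem consG_one (i : I) (t : S.Trace) : consG (1 : G i) t = t := dif_pos rfl

theorem consG_of_ne {i : I} {a : G i} (h : a ≠ 1) (t : S.Trace) : consG a t = cons ⟨a, h⟩ t :=
  dif_neg h

theorem Red.consG {i : I} {t : S.Trace} (ht : Red t) (hi : ¬ Head i t) (a : G i) :
    Red (consG a t) := by
  by_cases h : a = 1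
  · rwa [h, consG_one]
  · rw [consG_of_ne h]; exact ht.cons hi

theorem Red.exists_eq_consG {t : S.Trace} (ht : Red t) (i : I) :
    ∃ (a : G i) (s : S.Trace), Red s ∧ ¬ Head i s ∧ t = Trace.consG a s := by
  by_cases h : Head i t
  · obtain ⟨x, s, rfl, rfl⟩ := h
    obtain ⟨h₁, h₂⟩ := ht.of_cons rfl
    exact ⟨x.val, s, h₁, h₂, (consG_of_ne x.ne_one s).symm⟩
  · exact ⟨1, t, ht, h, (consG_one i t).symm⟩

/-- Distinct leading letters of one trace swap, and a swap never brings forward a letter of the same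
index. -/
theorem eq_of_consG_eq {i : I} {a b : G i} {t s : S.Trace} (ht : ¬ Head i t) (hs : ¬ Head i s)
    (h : consG a t = consG b s) : a = b ∧ t = s := by
  by_cases ha : a = 1
  · by_cases hb : b = 1
    · subst ha hb
      rw [consG_one, consG_one] at h
      exact ⟨rfl, h⟩
    · rw [ha, consG_one, consG_of_ne hb] at h
      exact absurd ⟨_, _, rfl, h⟩ ht
  · by_cases hb : b = 1
    · rw [hb, consG_one, consG_of_ne ha] at h
      exact absurd ⟨_, _, rfl, h.symm⟩ hs
    · rw [consG_of_ne ha, consG_of_ne hb] at h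
      rcases cons_eq_cons h with ⟨h', rfl⟩ | ⟨_, _, _, _, _, h'⟩
      · cases h'; exact ⟨rfl, rfl⟩
      · exact absurd rfl h'.idx_ne

open Classical in
/-- The action of an element of a factor on the reduced words up to commutations. -/
noncomputable def act {i : I} (a : G i) (t : S.Trace) : S.Trace :=
  if h : ∃ p : G i × S.Trace, Red p.2 ∧ ¬ Head i p.2 ∧ t = consG p.1 p.2 then
    consG (a * h.choose.1) h.choose.2
  -- Fixing the traces that are not `Red` lets the relations hold on all traces, with no subtype
  -- needed.
  else t

theorem act_consG {i : I} (a b : G i) {t : S.Trace} (ht : Red t) (hi : ¬ Head i t) :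
    act a (consG b t) = consG (a * b) t := by
  have h : ∃ p : G i × S.Trace, Red p.2 ∧ ¬ Head i p.2 ∧ consG b t = consG p.1 p.2 :=
    ⟨(b, t), ht, hi, rfl⟩
  obtain ⟨-, h₂, h₃⟩ := h.choose_spec
  obtain ⟨e₁, e₂⟩ := eq_of_consG_eq hi h₂ h₃
  rw [act, dif_pos h, ← e₁, ← e₂]

theorem act_of_not_red {i : I} (a : G i) {t : S.Trace} (ht : ¬ Red t) : act a t = t := by
  rw [act, dif_neg]
  rintro ⟨p, h₁, h₂, rfl⟩
  exact ht (h₁.consG h₂ _)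

theorem act_of_not_head {i : I} (a : G i) {t : S.Trace} (ht : Red t) (hi : ¬ Head i t) :
    act a t = consG a t := by
  have := act_consG a 1 ht hi
  rwa [consG_one, mul_one] at this

theorem Red.act {i : I} (a : G i) {t : S.Trace} (ht : Red t) : Red (act a t) := by
  obtain ⟨b, s, hs, hi, rfl⟩ := ht.exists_eq_consG i
  rw [act_consG a b hs hi]
  exact hs.consG hi _

theorem act_one (i : I) (t : S.Trace) : act (1 : G i) t = t := by
  by_cases ht : Red t
  · obtain ⟨b, s, hs, hi, rfl⟩ := ht.exists_eq_consG i
    rw [act_consG _ b hs hi, one_mul]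
  · exact act_of_not_red _ ht

theorem act_mul {i : I} (a b : G i) (t : S.Trace) : act (a * b) t = act a (act b t) := by
  by_cases ht : Red t
  · obtain ⟨c, s, hs, hi, rfl⟩ := ht.exists_eq_consG i
    rw [act_consG _ c hs hi, act_consG _ c hs hi, act_consG _ _ hs hi, mul_assoc]
  · rw [act_of_not_red _ ht, act_of_not_red _ ht, act_of_not_red _ ht]

/-- A letter below `j` passes the letters of `G j` without changing them, so it neither hides nor
creates a leading factor there. -/
theorem head_consG_iff {i j : I} (hij : i < j ∨ Oposet.Perp i j) (c : G i) (s : S.Trace) :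
    Head j (consG c s) ↔ Head j s := by
  by_cases hc : c = 1
  · rw [hc, consG_one]
  rw [consG_of_ne hc]
  constructor
  · rintro ⟨z, r, rfl, h⟩
    rcases cons_eq_cons h with ⟨rfl, -⟩ | ⟨z', c', v, rfl, rfl, h'⟩
    · exact absurd rfl (not_below_self (a := ⟨c, hc⟩) (b := ⟨c, hc⟩) hij)
    · exact ⟨z', v, h'.idx_eq_of_below hij, rfl⟩
  · rintro ⟨z, r, rfl, rfl⟩
    have h : Letter.Below ⟨c, hc⟩ z := hij
    exact ⟨z, cons (S.lstar z ⟨c, hc⟩) r, rfl, cons_cons (Or.inl ⟨h, rfl, rfl⟩) r⟩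

/-! ### The defining relations hold for the action -/

section Exchange

variable {i i' j : I} {y : G j} {hy : y ≠ 1} {φ : G i ≃* G i'}

theorem consG_consG
    (hφ : ∀ (x : G i) (hx : x ≠ 1) (hx' : φ x ≠ 1), S.SwapLeft ⟨x, hx⟩ ⟨y, hy⟩ ⟨y, hy⟩ ⟨φ x, hx'⟩)
    (x : G i) (t : S.Trace) : consG x (consG y t) = consG y (consG (φ x) t) := by
  by_cases hx : x = 1
  · rw [hx, map_one, consG_one, consG_one]
  · have hx' : φ x ≠ 1 := fun h => hx (φ.injective (h.trans (map_one φ).symm))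
    rw [consG_of_ne hx, consG_of_ne hx', consG_of_ne hy, consG_of_ne hy]
    exact cons_cons (Or.inl (hφ x hx hx')) t

/-- The map `φ` stands for passing `y`: the identity for orthogonal indices, `y ∗ ·` for `i < j`.
The leading factor of `t` in `G i'` is pulled back through `φ` to a leading factor in `G i` of `y
t`, where `a` multiplies it. The first conclusion allows elements of `G j` to act afterwards by
multiplying `y`. -/
theorem not_head_act_and_act_consG (hij' : i' < j ∨ Oposet.Perp i' j)
    (hφ : ∀ (x : G i) (hx : x ≠ 1) (hx' : φ x ≠ 1), S.SwapLeft ⟨x, hx⟩ ⟨y, hy⟩ ⟨y, hy⟩ ⟨φ x, hx'⟩)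
    (a : G i) {t : S.Trace} (ht : Red t) (hj : ¬ Head j t) :
    ¬ Head j (act (φ a) t) ∧ act a (consG y t) = consG y (act (φ a) t) := by
  obtain ⟨c, s, hs, hi', rfl⟩ := ht.exists_eq_consG i'
  obtain ⟨x, rfl⟩ := φ.surjective c
  rw [head_consG_iff hij'] at hj
  -- A leading letter in `G i` would have passed `y`, so `s` would already have a leading letter in
  -- `G i'`.
  have hi : ¬ Head i (consG y s) := by
    rw [consG_of_ne hy]
    rintro ⟨z, r, rfl, h⟩
    have hz' : φ z.val ≠ 1 := fun h => z.ne_one (φ.injective (h.trans (map_one φ).symm))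
    have hz := hφ z.val z.ne_one hz'
    rcases cons_eq_cons h with ⟨rfl, -⟩ | ⟨z', y'', v, rfl, rfl, h'⟩
    · exact (Swap.idx_ne (Or.inl hz)) rfl
    · exact hi' ⟨z', v, Swap.idx_eq (Or.inl hz) h' rfl, rfl⟩
  refine ⟨by rwa [act_consG _ _ hs hi', head_consG_iff hij'], ?_⟩
  rw [← consG_consG hφ, act_consG _ _ (hs.consG hj y) hi, act_consG _ _ hs hi', ← map_mul,
    consG_consG hφ]

end Exchange

theorem act_act_of_perp {i j : I} (h : Oposet.Perp i j) (a : G i) (b : G j) (t : S.Trace) :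
    act a (act b t) = act b (act a t) := by
  by_cases ht : Red t
  swap
  · rw [act_of_not_red _ ht, act_of_not_red _ ht, act_of_not_red _ ht]
  obtain ⟨y, s, hs, hj, rfl⟩ := ht.exists_eq_consG j
  have key : ∀ y : G j, ¬ Head j (act a s) ∧ act a (consG y s) = consG y (act a s) := by
    intro y
    have hj' : ¬ Head j (act a s) := by
      obtain ⟨c, r, hr, hi, rfl⟩ := hs.exists_eq_consG i
      rw [act_consG _ _ hr hi, head_consG_iff (Or.inr h)]
      rwa [head_consG_iff (Or.inr h)] at hj
    by_cases hy : y = 1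
    · rw [hy, consG_one, consG_one]; exact ⟨hj', rfl⟩
    · exact not_head_act_and_act_consG (hy := hy) (φ := MulEquiv.refl (G i)) (Or.inr h)
        (fun x hx hx' => ⟨Or.inr h, rfl, (S.lstar_of_perp h).symm⟩) a hs hj
  rw [act_consG _ _ hs hj, (key _).2, (key y).2, act_consG _ _ (hs.act a) (key y).1]

theorem act_eq_act_of_sigma_eq {i j : I} {a : G i} {b : G j}
    (h : (⟨i, a⟩ : Σ i, G i) = ⟨j, b⟩) (t : S.Trace) : act a t = act b t := by
  cases h; rfl

theorem act_act_of_lt {i j : I} (h : i < j) (a : G i) (b : G j) (t : S.Trace) :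
    act a (act b t) = act b (act (S.star h b a) t) := by
  by_cases ht : Red t
  swap
  · rw [act_of_not_red _ ht, act_of_not_red _ ht, act_of_not_red _ ht, act_of_not_red _ ht]
  obtain ⟨y, s, hs, hj, rfl⟩ := ht.exists_eq_consG j
  have key : ∀ {k : I} (hk : k < j) (y : G j) (c : G k), ¬ Head j (act (S.star hk y c) s) ∧
      act c (consG y s) = consG y (act (S.star hk y c) s) := by
    intro k hk y c
    by_cases hy : y = 1
    · subst hy
      have e : (⟨S.starIdx hk 1, S.star hk 1 c⟩ : Σ i, G i) = ⟨k, c⟩ :=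
        congrArg (fun x : Σ i : Set.Iio j, G i => (⟨x.1.1, x.2⟩ : Σ i, G i))
          (S.act_one j ⟨⟨k, hk⟩, c⟩)
      rw [act_eq_act_of_sigma_eq e, consG_one, consG_one]
      refine ⟨?_, rfl⟩
      obtain ⟨d, r, hr, hi, rfl⟩ := hs.exists_eq_consG k
      rw [act_consG _ _ hr hi, head_consG_iff (Or.inl hk)]
      rwa [head_consG_iff (Or.inl hk)] at hj
    · exact not_head_act_and_act_consG (hy := hy) (φ := (S.act y).iso ⟨k, hk⟩)
        (Or.inl (S.starIdx_lt hk y))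
        (fun x hx hx' => ⟨Or.inl hk, rfl, (S.lstar_of_lt (a := ⟨x, hx⟩) (b := ⟨y, hy⟩) hk).symm⟩)
        c hs hj
  -- Both sides of the goal are `b * y` in front of a trace acted on by a star of `a`; the two stars
  -- agree because actions compose in the order of the product.
  have e : (⟨_, S.star h (b * y) a⟩ : Σ i, G i) =
      ⟨_, S.star (S.starIdx_lt h b) y (S.star h b a)⟩ :=
    congrArg (fun x : Σ i : Set.Iio j, G i => (⟨x.1.1, x.2⟩ : Σ i, G i))
      (S.act_mul j b y ⟨⟨i, h⟩, a⟩)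
  rw [act_consG _ _ hs hj, (key h _ _).2, (key (S.starIdx_lt h b) _ _).2,
    act_consG _ _ (hs.act _) (key _ _ _).1, act_eq_act_of_sigma_eq e]

end Trace

/-! ### The action of the quandle product -/

variable (S)

/-- The action of the quandle product on the words up to commutations. -/
noncomputable def traceAction : S.Product →* Function.End S.Trace :=
  QuotientGroup.lift (Subgroup.normalClosure S.relators)
    (CoprodI.lift fun i =>
      ({ toFun := fun a => Trace.act a
         map_one' := funext fun t => Trace.act_one i t
         map_mul' := fun a b => funext fun t => Trace.act_mul a b t } :
        G i →* Function.End S.Trace))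
    (by
      refine Subgroup.normalClosure_le_normal ?_
      -- The target is only a monoid, so `f x = f y` is multiplied by `f y⁻¹` instead of being
      -- divided by `f y`.
      have key : ∀ {M : Type _} [Monoid M] (f : CoprodI G →* M) (x y : CoprodI G),
          f x = f y → x * y⁻¹ ∈ f.ker := by
        intro M _ f x y h
        rw [MonoidHom.mem_ker, map_mul, h, ← map_mul, mul_inv_cancel, map_one]
      rintro _ (⟨i, j, a, b, h, rfl⟩ | ⟨i, j, h, a, b, rfl⟩)
      · apply key
        simp only [map_mul, CoprodI.lift_of]
        exact funext fun t => Trace.act_act_of_perp h a b t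
      · apply key
        simp only [map_mul, CoprodI.lift_of]
        exact funext fun t => Trace.act_act_of_lt h a b t)

theorem traceAction_mul (g h : S.Product) (t : S.Trace) :
    S.traceAction (g * h) t = S.traceAction g (S.traceAction h t) := by
  rw [map_mul]; rfl

theorem traceAction_of {i : I} (a : G i) (t : S.Trace) :
    S.traceAction (QuotientGroup.mk (CoprodI.of a)) t = Trace.act a t := by
  simp [traceAction]
  rfl

theorem eval_cons (x : Letter G) (w : List (Letter G)) :
    S.eval (x :: w) = QuotientGroup.mk (CoprodI.of x.val) * S.eval w := by
  simp [eval]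

theorem eval_append (u v : List (Letter G)) : S.eval (u ++ v) = S.eval u * S.eval v := by
  simp [eval]

variable {S}

/-! ### Reduced words and shortest words -/

theorem isReduced_of_cons {x : Letter G} {w : List (Letter G)} (h : S.IsReduced (x :: w)) :
    S.IsReduced w := by
  intro w' hw
  have := h (x :: w') (Relation.ReflTransGen.lift (List.cons x) ?_ _ _ hw)
  · simpa using this
  · rintro u v (h | h)
    · exact Or.inl (h.cons x)
    · refine Or.inr ?_
      cases h with
      | cancel u v a b ha hb hab => exact .cancel (x :: u) v a b ha hb hab
      | merge u v a b ha hb hab => exact .merge (x :: u) v a b ha hb hab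

/-- Otherwise commutations would bring a letter of the same factor next to `x`, and a fusion would
shorten the word. -/
theorem IsReduced.not_head {x : Letter G} {w : List (Letter G)} (h : S.IsReduced (x :: w)) :
    ¬ Trace.Head x.idx (Trace.mk w : S.Trace) := by
  rintro ⟨y, s, hy, e⟩
  induction s using Quotient.inductionOn with | h u => ?_
  have e' : Relation.ReflTransGen S.Commutation w (y :: u) := Trace.mk_eq_mk.1 e
  have h₁ : Relation.ReflTransGen S.Move (x :: w) (x :: y :: u) :=
    Relation.ReflTransGen.lift (List.cons x) (fun _ _ h => Or.inl (h.cons x)) _ _ e'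
  have hlen := length_eq_of_reflTransGen e'
  obtain ⟨x, hx⟩ := x
  obtain ⟨y, hy'⟩ := y
  dsimp only at hy
  subst hy
  by_cases hxy : x * y = 1
  · have := h _ (h₁.tail (Or.inr (.cancel [] u x y hx hy' hxy)))
    simp at this hlen
    omega
  · have := h _ (h₁.tail (Or.inr (.merge [] u x y hx hy' hxy)))
    simp at this hlen
    omega

theorem IsReduced.red {w : List (Letter G)} (h : S.IsReduced w) :
    Trace.Red (Trace.mk w : S.Trace) := by
  induction w with
  | nil => exact .nil
  | cons x w ih => exact (ih (isReduced_of_cons h)).cons h.not_head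

/-- Reading from the right, no letter meets a leading letter of its own factor, so each one acts by
being put in front: the element determines the trace. -/
theorem IsReduced.traceAction_eval {w : List (Letter G)} (h : S.IsReduced w) :
    S.traceAction (S.eval w) (Trace.mk []) = Trace.mk w := by
  induction w with
  | nil => simp [eval]; rfl
  | cons x w ih =>
    have hw := isReduced_of_cons h
    rw [eval_cons, traceAction_mul, ih hw, traceAction_of, Trace.act_of_not_head _ hw.red h.not_head,
      Trace.consG_of_ne x.ne_one]
    rfl

theorem mk_of_mul_of_perp {i j : I} (h : Oposet.Perp i j) (a : G i) (b : G j) :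
    (QuotientGroup.mk (CoprodI.of a) * QuotientGroup.mk (CoprodI.of b) : S.Product) =
      QuotientGroup.mk (CoprodI.of b) * QuotientGroup.mk (CoprodI.of a) := by
  rw [← QuotientGroup.mk_mul, ← QuotientGroup.mk_mul, eq_comm, ← mul_inv_eq_one,
    ← QuotientGroup.mk_inv, ← QuotientGroup.mk_mul, QuotientGroup.eq_one_iff]
  exact Subgroup.subset_normalClosure (Or.inl ⟨j, i, b, a, Oposet.perp_symm _ _ h, rfl⟩)

theorem mk_of_mul_of_lt {i j : I} (h : i < j) (a : G i) (b : G j) :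
    (QuotientGroup.mk (CoprodI.of a) * QuotientGroup.mk (CoprodI.of b) : S.Product) =
      QuotientGroup.mk (CoprodI.of b) * QuotientGroup.mk (CoprodI.of (S.star h b a)) := by
  rw [← QuotientGroup.mk_mul, ← QuotientGroup.mk_mul, ← mul_inv_eq_one, ← QuotientGroup.mk_inv,
    ← QuotientGroup.mk_mul, QuotientGroup.eq_one_iff]
  exact Subgroup.subset_normalClosure (Or.inr ⟨i, j, h, a, b, rfl⟩)

theorem SwapLeft.mk_mul {a b c d : Letter G} (h : S.SwapLeft a b c d) :
    (QuotientGroup.mk (CoprodI.of a.val) * QuotientGroup.mk (CoprodI.of b.val) : S.Product) =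
      QuotientGroup.mk (CoprodI.of c.val) * QuotientGroup.mk (CoprodI.of d.val) := by
  obtain ⟨h | h, rfl, rfl⟩ := h
  · rw [S.lstar_of_lt h]; exact mk_of_mul_of_lt h _ _
  · rw [S.lstar_of_perp h]; exact mk_of_mul_of_perp h _ _

theorem Move.eval_eq {w w' : List (Letter G)} (h : S.Move w w') : S.eval w = S.eval w' := by
  rcases h with h | h
  · rw [commutation_iff] at h
    obtain ⟨u, v, a, b, c, d, h, rfl, rfl⟩ := h
    have := h.elim SwapLeft.mk_mul fun h => h.mk_mul.symm
    simp only [eval_append, eval_cons, ← mul_assoc _ _ (S.eval v), this]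
  · cases h with
    | cancel u v a b ha hb hab =>
      simp only [eval_append, eval_cons, ← mul_assoc _ _ (S.eval v), ← QuotientGroup.mk_mul,
        ← map_mul, hab, map_one, QuotientGroup.mk_one, one_mul]
    | merge u v a b ha hb hab =>
      simp only [eval_append, eval_cons, ← mul_assoc _ _ (S.eval v), ← QuotientGroup.mk_mul,
        ← map_mul]

theorem IsShortest.isReduced {g : S.Product} {w : List (Letter G)} (h : S.IsShortest g w) :
    S.IsReduced w := by
  intro w' hw
  refine h.2 w' (Eq.trans ?_ h.1)
  induction hw with
  | refl => rfl
  | tail _ h ih => exact h.eval_eq.symm.trans ih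

theorem IsReduced.reflTransGen {w w' : List (Letter G)} (h : S.IsReduced w) (h' : S.IsReduced w')
    (e : S.eval w = S.eval w') : Relation.ReflTransGen S.Commutation w w' := by
  rw [← Trace.mk_eq_mk, ← h.traceAction_eval, ← h'.traceAction_eval, e]

theorem exists_isShortest (w : List (Letter G)) : ∃ w', S.IsShortest (S.eval w) w' := by
  classical
  have h : ∃ n, ∃ w' : List (Letter G), S.eval w' = S.eval w ∧ w'.length = n := ⟨_, w, rfl, rfl⟩
  obtain ⟨w', h₁, h₂⟩ := Nat.find_spec h
  exact ⟨w', h₁, fun v hv => h₂.trans_le (Nat.find_min' h ⟨v, hv, rfl⟩)⟩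

end QuandleSystem

theorem mainTheorem5 {I : Type*} [Oposet I] {G : I → Type*} [∀ i, Group (G i)]
    (S : QuandleSystem I G) (g : S.Product) :
    (∀ w : List (Letter G), S.eval w = g → (S.IsShortest g w ↔ S.IsReduced w)) ∧
      (∀ w w' : List (Letter G), S.IsShortest g w → S.IsShortest g w' →
        Relation.ReflTransGen S.Commutation w w') := by
  refine ⟨fun w hw => ⟨fun h => h.isReduced, fun h => ?_⟩, fun w w' h h' =>
    h.isReduced.reflTransGen h'.isReduced (h.1.trans h'.1.symm)⟩
  subst hw
  -- A shortest word for the same element is reduced, hence has the length of `w`.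
  obtain ⟨w', h'⟩ := QuandleSystem.exists_isShortest (S := S) w
  have := QuandleSystem.length_eq_of_reflTransGen (h.reflTransGen h'.isReduced h'.1.symm)
  exact ⟨rfl, fun v hv => this.trans_le (h'.2 v hv)⟩
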